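/- Let $n\ge 1$ be an integer and let $x_1,x_2,\ldots,x_n\in\mathbb C$ be the (distinct) zeroes of the polynomial $x^n-1$, listed in any order. Let $\mathcal I(n)$ denote the set of involutions on $\{1,2,\ldots,n\}$, i.e. of all permutations $\sigma$ with $\sigma^2=\mathrm{id}$ (including the identity). Then $$ \sum_{\sigma\in\mathcal I(n)}\ \prod_{(ij)\in\sigma}\frac{1}{(x_i-x_j)^2}\ \prod_{(k)\in\sigma}\frac{n+1}{2x_k}=(-1)^{n+1}\,n!, $$ where, for each $\sigma$, the first product is over all transpositions $(ij)$ in the disjoint cycle decomposition of $\sigma$ (each taken once), the second product is over all fixed points $k$ of $\sigma$, and empty products are equal to $1$. -/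

import Mathlib

open Finset

/-- The involutions of `{1, …, n}`: the permutations `σ` with `σ (σ i) = i` for all `i`,
the identity included. -/
def involutions (n : ℕ) : Finset (Equiv.Perm (Fin n)) :=
  univ.filter fun σ => ∀ i, σ (σ i) = i

/-- The transpositions `(i j)` in the disjoint cycle decomposition of `σ`, each listed once, as the
pair with `i < j`. -/
def transpositions {n : ℕ} (σ : Equiv.Perm (Fin n)) : Finset (Fin n × Fin n) :=
  univ.filter fun p => p.1 < p.2 ∧ σ p.1 = p.2 ∧ σ p.2 = p.1

/-- The fixed points of `σ`. -/
def fixedPts {n : ℕ} (σ : Equiv.Perm (Fin n)) : Finset (Fin n) :=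
  univ.filter fun k => σ k = k

/-! Up to sign bookkeeping, the sum over involutions is a determinant. For distinct `x i` and any
diagonal `p`, the non-involutions cancel in the Leibniz expansion of `(cauchyMoser x p).det`
(`sum_nonInvTerm`). The proof is by induction: splice a new point into each arrow of a smaller
permutation; partial fractions make the contributions telescope around its cycles.

For the roots of unity and `p k = (n + 1) / (2 * x k)`, the matrix `C` satisfies `C * diag(x) * V =
V * diag(1, …, n)` with `V` the Vandermonde matrix (`cauchyMoser_mul_pow`). Hence `det C * ∏ x i =
n!`, where `∏ x i = (-1) ^ (n + 1)`. -/

/-- The matrix with diagonal `p` and off-diagonal entries `1 / (x i - x j)`. -/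
noncomputable def cauchyMoser {ι K : Type*} [DecidableEq ι] [Field K] (x p : ι → K) :
    Matrix ι ι K :=
  Matrix.of fun i j => if i = j then p i else 1 / (x i - x j)

/-- The term of `σ` in the Leibniz expansion of `(cauchyMoser x p).det`. -/
noncomputable def leibnizTerm {ι K : Type*} [DecidableEq ι] [Fintype ι] [Field K] (x p : ι → K)
    (σ : Equiv.Perm ι) : K :=
  ((Equiv.Perm.sign σ : ℤ) : K) * ∏ i, cauchyMoser x p (σ i) i

/-- The Leibniz term of `σ`, with `0` in place of it when `σ` is an involution. -/
noncomputable def nonInvTerm {ι K : Type*} [DecidableEq ι] [Fintype ι] [Field K] (x p : ι → K)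
    (σ : Equiv.Perm ι) : K :=
  if ∀ i, σ (σ i) = i then 0 else leibnizTerm x p σ

/-! ### Cancellation of the non-involutions -/

section General

variable {K : Type*} [Field K]

theorem cauchyMoser_self {ι : Type*} [DecidableEq ι] (x p : ι → K) (i : ι) :
    cauchyMoser x p i i = p i := by
  simp [cauchyMoser]

theorem cauchyMoser_of_ne {ι : Type*} [DecidableEq ι] (x p : ι → K) {i j : ι} (h : i ≠ j) :
    cauchyMoser x p i j = 1 / (x i - x j) := by
  simp [cauchyMoser, h]

theorem cauchyMoser_succ {n : ℕ} (x p : Fin (n + 1) → K) (i j : Fin n) :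
    cauchyMoser x p i.succ j.succ = cauchyMoser (fun k => x k.succ) (fun k => p k.succ) i j := by
  simp [cauchyMoser]

theorem cauchyMoser_update {ι : Type*} [DecidableEq ι] (x p : ι → K) (l : ι) (a : K) {i j : ι}
    (h : i ≠ l ∨ j ≠ l) :
    cauchyMoser x (Function.update p l a) i j = cauchyMoser x p i j := by
  by_cases hij : i = j
  · subst hij
    have : i ≠ l := by tauto
    simp [cauchyMoser_self, this]
  · simp [cauchyMoser_of_ne _ _ hij]

open Equiv.Perm in
theorem nonInvTerm_decomposeFin_zero {n : ℕ} (x p : Fin (n + 1) → K) (τ : Equiv.Perm (Fin n)) :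
    nonInvTerm x p (decomposeFin.symm (0, τ)) =
      p 0 * nonInvTerm (fun k => x k.succ) (fun k => p k.succ) τ := by
  have hinv : (∀ i : Fin (n + 1), decomposeFin.symm ((0 : Fin (n + 1)), τ)
      (decomposeFin.symm ((0 : Fin (n + 1)), τ) i) = i) ↔ ∀ i, τ (τ i) = i := by
    simp [Fin.forall_fin_succ]
  unfold nonInvTerm
  simp only [hinv, mul_ite, mul_zero]
  congr 1
  simp only [leibnizTerm, decomposeFin.symm_sign, if_true, one_mul, Fin.prod_univ_succ,
    decomposeFin_symm_apply_zero, decomposeFin_symm_apply_succ, Equiv.swap_self, Equiv.refl_apply,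
    cauchyMoser_self, cauchyMoser_succ]
  ring

-- With first component `(τ l).succ`, `decomposeFin.symm` replaces the arrow `l → τ l` by `l → 0 → τ
-- l`.
open Equiv.Perm in
theorem decomposeFin_symm_apply_succ_of_ne {n : ℕ} (τ : Equiv.Perm (Fin n)) {l j : Fin n}
    (h : j ≠ l) : decomposeFin.symm ((τ l).succ, τ) j.succ = (τ j).succ := by
  rw [decomposeFin_symm_apply_succ, Equiv.swap_apply_of_ne_of_ne (Fin.succ_ne_zero _)]
  simpa using h

open Equiv.Perm in
theorem decomposeFin_symm_apply_succ_self {n : ℕ} (τ : Equiv.Perm (Fin n)) (l : Fin n) :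
    decomposeFin.symm ((τ l).succ, τ) l.succ = 0 := by
  rw [decomposeFin_symm_apply_succ, Equiv.swap_apply_right]

open Equiv.Perm in
theorem decomposeFin_symm_involutive_iff {n : ℕ} (τ : Equiv.Perm (Fin n)) (l : Fin n) :
    (∀ i, decomposeFin.symm ((τ l).succ, τ) (decomposeFin.symm ((τ l).succ, τ) i) = i) ↔
      τ l = l ∧ ∀ i, τ (τ i) = i := by
  rw [Fin.forall_fin_succ, decomposeFin_symm_apply_zero]
  constructor
  · rintro ⟨h0, hs⟩
    have hl : τ l = l := by
      by_contra h
      rw [decomposeFin_symm_apply_succ_of_ne τ h] at h0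
      exact Fin.succ_ne_zero _ h0
    refine ⟨hl, fun i => ?_⟩
    by_cases hi : i = l
    · rw [hi, hl, hl]
    · have hi' : τ i ≠ l := fun h => hi (τ.injective (h.trans hl.symm))
      have := hs i
      rwa [decomposeFin_symm_apply_succ_of_ne τ hi, decomposeFin_symm_apply_succ_of_ne τ hi',
        Fin.succ_inj] at this
  · rintro ⟨hl, h⟩
    refine ⟨?_, fun i => ?_⟩
    · conv_lhs => rw [show (τ l).succ = l.succ by rw [hl]]
      have := decomposeFin_symm_apply_succ_self τ l
      rwa [hl] at this
    by_cases hi : i = l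
    · rw [hi, decomposeFin_symm_apply_succ_self, decomposeFin_symm_apply_zero, hl]
    · have hi' : τ i ≠ l := fun h => hi (τ.injective (h.trans hl.symm))
      rw [decomposeFin_symm_apply_succ_of_ne τ hi, decomposeFin_symm_apply_succ_of_ne τ hi', h]

open Equiv.Perm in
theorem leibnizTerm_decomposeFin_succ {n : ℕ} (x p : Fin (n + 1) → K) (τ : Equiv.Perm (Fin n))
    (l : Fin n) :
    leibnizTerm x p (decomposeFin.symm ((τ l).succ, τ)) =
      -((sign τ : ℤ) : K) * (1 / (x (τ l).succ - x 0) * (1 / (x 0 - x l.succ)) *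
        ∏ j ∈ univ.erase l, cauchyMoser (fun k => x k.succ) (fun k => p k.succ) (τ j) j) := by
  rw [leibnizTerm, decomposeFin.symm_sign, if_neg (Fin.succ_ne_zero _), Fin.prod_univ_succ,
    ← mul_prod_erase univ _ (mem_univ l), decomposeFin_symm_apply_zero,
    decomposeFin_symm_apply_succ_self, cauchyMoser_of_ne _ _ (Fin.succ_ne_zero _),
    cauchyMoser_of_ne _ _ (Fin.succ_ne_zero _).symm]
  have : ∏ j ∈ univ.erase l, cauchyMoser x p (decomposeFin.symm ((τ l).succ, τ) j.succ) j.succ =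
      ∏ j ∈ univ.erase l, cauchyMoser (fun k => x k.succ) (fun k => p k.succ) (τ j) j := by
    refine prod_congr rfl fun j hj => ?_
    rw [decomposeFin_symm_apply_succ_of_ne τ (ne_of_mem_erase hj), cauchyMoser_succ]
  rw [this]
  push_cast
  ring

theorem leibnizTerm_update_of_ne {n : ℕ} (x p : Fin n → K) (τ : Equiv.Perm (Fin n)) {l : Fin n}
    (h : τ l ≠ l) (a : K) : leibnizTerm x (Function.update p l a) τ = leibnizTerm x p τ := by
  unfold leibnizTerm
  congr 1
  refine prod_congr rfl fun j _ => cauchyMoser_update _ _ _ _ ?_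
  by_cases hj : j = l
  · left; rwa [hj]
  · exact Or.inr hj

theorem leibnizTerm_update_of_eq {n : ℕ} (x p : Fin n → K) (τ : Equiv.Perm (Fin n)) {l : Fin n}
    (h : τ l = l) (a : K) : leibnizTerm x (Function.update p l a) τ =
      a * (((Equiv.Perm.sign τ : ℤ) : K) * ∏ j ∈ univ.erase l, cauchyMoser x p (τ j) j) := by
  unfold leibnizTerm
  have : ∏ j ∈ univ.erase l, cauchyMoser x (Function.update p l a) (τ j) j =
      ∏ j ∈ univ.erase l, cauchyMoser x p (τ j) j :=
    prod_congr rfl fun j hj => cauchyMoser_update _ _ _ _ (Or.inr (ne_of_mem_erase hj))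
  rw [← mul_prod_erase univ _ (mem_univ l), this, h, cauchyMoser_self, Function.update_self]
  ring

open Equiv.Perm in
/-- Inserting a new point into `τ` in front of `τ l`. -/
theorem nonInvTerm_decomposeFin_succ {n : ℕ} (x p : Fin (n + 1) → K)
    (hx : Function.Injective x) (τ : Equiv.Perm (Fin n)) (l : Fin n) :
    nonInvTerm x p (decomposeFin.symm ((τ l).succ, τ)) =
      1 / (x l.succ - x 0) ^ 2 *
        (nonInvTerm (fun k => x k.succ) (Function.update (fun k => p k.succ) l 1) τ -
          nonInvTerm (fun k => x k.succ) (Function.update (fun k => p k.succ) l 0) τ) +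
      leibnizTerm (fun k => x k.succ) (fun k => p k.succ) τ *
        (1 / (x 0 - x (τ l).succ) - 1 / (x 0 - x l.succ)) := by
  have hne : ∀ i j, i ≠ j → x i - x j ≠ 0 := fun i j h => sub_ne_zero.2 (hx.ne h)
  have h1 := hne _ _ (Fin.succ_ne_zero l)
  have h2 := hne _ _ (Fin.succ_ne_zero l).symm
  simp only [nonInvTerm, decomposeFin_symm_involutive_iff]
  -- If `l` is fixed, the new 2-cycle replaces the factor `p l`. Since the term is linear in `p l`,
  -- its coefficient is the value at 1 minus the value at 0.
  by_cases hl : τ l = l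
  · by_cases hinv : ∀ i, τ (τ i) = i
    · simp [hl, hinv]
    · simp only [hinv, and_false, if_false]
      rw [leibnizTerm_decomposeFin_succ, leibnizTerm_update_of_eq _ _ _ hl,
        leibnizTerm_update_of_eq _ _ _ hl, hl]
      field_simp
      ring
  -- Otherwise the result is never an involution, even if `τ` is one, hence `leibnizTerm` rather
  -- than `nonInvTerm`. Partial fractions split the two new matrix entries.
  · have h3 := hne _ _ (Fin.succ_ne_zero (τ l))
    have h4 := hne _ _ (Fin.succ_ne_zero (τ l)).symm
    have h5 : x (τ l).succ - x l.succ ≠ 0 := hne _ _ (by simpa using hl)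
    rw [leibnizTerm_update_of_ne _ _ _ hl, leibnizTerm_update_of_ne _ _ _ hl, sub_self, mul_zero,
      zero_add, if_neg (fun h => hl h.1), leibnizTerm_decomposeFin_succ, leibnizTerm,
      ← mul_prod_erase univ _ (mem_univ l), cauchyMoser_of_ne _ _ hl]
    field_simp
    ring

/-- The Leibniz terms of the permutations that are not involutions add up to zero. -/
theorem sum_nonInvTerm {n : ℕ} (x p : Fin n → K) (hx : Function.Injective x) :
    ∑ σ, nonInvTerm x p σ = 0 := by
  induction n with
  | zero => exact sum_eq_zero fun σ _ => if_pos fun i => i.elim0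
  | succ n ih =>
    have hx' : Function.Injective fun k : Fin n => x k.succ :=
      hx.comp (Fin.succ_injective n)
    rw [← Equiv.Perm.decomposeFin.symm.sum_comp, Fintype.sum_prod_type, Fin.sum_univ_succ]
    simp only [nonInvTerm_decomposeFin_zero]
    rw [← mul_sum, ih _ _ hx', mul_zero, zero_add, sum_comm]
    have key : ∀ τ : Equiv.Perm (Fin n),
        ∑ i : Fin n, nonInvTerm x p (Equiv.Perm.decomposeFin.symm (i.succ, τ)) =
          ∑ l : Fin n, 1 / (x l.succ - x 0) ^ 2 *
            (nonInvTerm (fun k => x k.succ) (Function.update (fun k => p k.succ) l 1) τ -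
              nonInvTerm (fun k => x k.succ) (Function.update (fun k => p k.succ) l 0) τ) := by
      intro τ
      -- Writing the image of 0 as `τ l` makes the differences sum to zero, as `τ` permutes the
      -- indices.
      rw [← Equiv.sum_comp τ]
      simp only [nonInvTerm_decomposeFin_succ x p hx]
      rw [sum_add_distrib, ← mul_sum, sum_sub_distrib,
        Equiv.sum_comp τ fun i => 1 / (x 0 - x i.succ), sub_self, mul_zero, add_zero]
    simp only [key]
    rw [sum_comm]
    refine sum_eq_zero fun l _ => ?_
    -- The induction hypothesis holds for every diagonal, so it applies to both updated ones.
    rw [← mul_sum, sum_sub_distrib, ih _ _ hx', ih _ _ hx', sub_self, mul_zero]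

theorem det_cauchyMoser_eq_sum_involutions {n : ℕ} (x p : Fin n → K)
    (hx : Function.Injective x) :
    (cauchyMoser x p).det = ∑ σ ∈ involutions n, leibnizTerm x p σ := by
  have h := sum_nonInvTerm x p hx
  rw [Matrix.det_apply']
  unfold involutions
  rw [sum_filter, ← sub_eq_zero, ← sum_sub_distrib]
  refine Eq.trans ?_ h
  refine sum_congr rfl fun σ _ => ?_
  unfold nonInvTerm
  split_ifs <;> simp [leibnizTerm]

/-! ### Leibniz terms of involutions -/

theorem prod_transpositions {n : ℕ} {M : Type*} [CommMonoid M] {σ : Equiv.Perm (Fin n)}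
    (hσ : ∀ i, σ (σ i) = i) (f : Fin n → Fin n → M) :
    ∏ q ∈ transpositions σ, f q.1 q.2 = ∏ i ∈ univ.filter (fun i => i < σ i), f i (σ i) := by
  symm
  refine prod_bij (fun i _ => (i, σ i)) ?_ ?_ ?_ ?_
  · intro i hi
    simpa [transpositions, hσ] using hi
  · intro i _ j _ h
    exact (Prod.ext_iff.1 h).1
  · rintro ⟨i, j⟩ h
    simp only [transpositions, mem_filter, mem_univ, true_and] at h
    exact ⟨i, by simpa [h.2.1] using h.1, by rw [h.2.1]⟩
  · intro i _
    rfl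

theorem prod_eq_prod_fixedPts_mul {n : ℕ} {M : Type*} [CommMonoid M] {σ : Equiv.Perm (Fin n)}
    (hσ : ∀ i, σ (σ i) = i) (g : Fin n → M) :
    ∏ i, g i = (∏ k ∈ fixedPts σ, g k) *
      ∏ i ∈ univ.filter (fun i => i < σ i), g i * g (σ i) := by
  have hgt : ∏ i ∈ univ.filter (fun i => σ i < i), g i =
      ∏ i ∈ univ.filter (fun i => i < σ i), g (σ i) := by
    refine prod_nbij' σ σ ?_ ?_ ?_ ?_ ?_ <;> simp [hσ]
  rw [prod_mul_distrib, ← hgt, fixedPts, ← prod_filter_mul_prod_filter_not univ (fun i => σ i = i)]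
  congr 1
  rw [← prod_filter_mul_prod_filter_not (univ.filter fun i => ¬ σ i = i) (fun i => i < σ i),
    filter_filter, filter_filter]
  congr 1 <;> refine prod_congr (filter_congr fun i _ => ?_) fun _ _ => rfl
  · exact ⟨fun h => h.2, fun h => ⟨h.ne', h⟩⟩
  · exact ⟨fun h => lt_of_le_of_ne (not_lt.1 h.2) h.1, fun h => ⟨h.ne, h.not_gt⟩⟩

theorem sign_eq_neg_one_pow_card_lt {n : ℕ} {σ : Equiv.Perm (Fin n)} (hσ : ∀ i, σ (σ i) = i) :
    Equiv.Perm.sign σ = (-1) ^ #(univ.filter fun i => i < σ i) := by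
  have hsq : σ ^ 2 = 1 := by
    ext i
    simp [pow_two, hσ]
  have hcard : n = #(fixedPts σ) + 2 * #(univ.filter fun i => i < σ i) := by
    -- The constant 2 turns the factorization into a count, by comparing exponents of 2.
    have h := prod_eq_prod_fixedPts_mul hσ (fun _ => 2)
    simp only [prod_const, card_univ, Fintype.card_fin, ← pow_two, ← pow_mul, ← pow_add] at h
    exact Nat.pow_right_injective le_rfl h
  have hfix : Fintype.card (Function.fixedPoints σ) = #(fixedPts σ) := by
    rw [fixedPts, ← Fintype.card_subtype]
    exact Fintype.card_congr (Equiv.refl _)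
  rw [Equiv.Perm.sign_of_pow_two_eq_one hsq, hfix, Fintype.card_fin]
  congr 1
  omega

/-- Each transposition contributes a sign -1, which cancels the one in `1 / (x i - x j) * (1 / (x j
- x i))`. -/
theorem leibnizTerm_of_involutive {n : ℕ} (x p : Fin n → K) {σ : Equiv.Perm (Fin n)}
    (hσ : ∀ i, σ (σ i) = i) :
    leibnizTerm x p σ =
      (∏ q ∈ transpositions σ, 1 / (x q.1 - x q.2) ^ 2) * ∏ k ∈ fixedPts σ, p k := by
  rw [prod_transpositions hσ (fun i j => 1 / (x i - x j) ^ 2), leibnizTerm,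
    sign_eq_neg_one_pow_card_lt hσ, prod_eq_prod_fixedPts_mul hσ, mul_left_comm, mul_comm]
  congr 1
  · push_cast
    rw [← prod_const, ← prod_mul_distrib]
    refine prod_congr rfl fun i hi => ?_
    have hlt : i < σ i := (mem_filter.1 hi).2
    rw [hσ, cauchyMoser_of_ne _ _ hlt.ne, cauchyMoser_of_ne _ _ hlt.ne', ← neg_sub (x i) (x (σ i)),
      one_div_neg_eq_neg_one_div, ← one_div_pow]
    ring
  · refine prod_congr rfl fun k hk => ?_
    rw [(mem_filter.1 hk).2, cauchyMoser_self]

end General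

/-! ### The determinant at the roots of unity -/

section RootsOfUnity

variable {n : ℕ}

/-- Multiplication by a primitive root `ζ` permutes the roots and scales the full power sum by `ζ ^
m ≠ 1`, so that sum vanishes. -/
theorem sum_erase_nthRootsFinset_pow {m : ℕ} (hm : 0 < m) (hmn : m < n) {a : ℂ} (ha : a ^ n = 1) :
    ∑ z ∈ (Polynomial.nthRootsFinset n (1 : ℂ)).erase a, z ^ m = -a ^ m := by
  have hn : 0 < n := hm.trans hmn
  have hζ := Complex.isPrimitiveRoot_exp n hn.ne'
  set ζ := Complex.exp (2 * Real.pi * Complex.I / n)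
  have hζ0 : ζ ≠ 0 := Complex.exp_ne_zero _
  have hsum : ∑ z ∈ Polynomial.nthRootsFinset n (1 : ℂ), z ^ m = 0 := by
    have h : ∑ z ∈ Polynomial.nthRootsFinset n (1 : ℂ), (ζ * z) ^ m =
        ∑ z ∈ Polynomial.nthRootsFinset n (1 : ℂ), z ^ m := by
      refine sum_nbij' (fun z => ζ * z) (fun z => ζ⁻¹ * z) ?_ ?_ ?_ ?_ ?_ <;>
        simp +contextual [Polynomial.mem_nthRootsFinset hn, mul_pow, hζ.pow_eq_one, hζ0]
    simp only [mul_pow] at h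
    rw [← mul_sum] at h
    have h1 : ζ ^ m ≠ 1 := hζ.pow_ne_one_of_pos_of_lt hm.ne' hmn
    have h2 : (ζ ^ m - 1) * ∑ z ∈ Polynomial.nthRootsFinset n (1 : ℂ), z ^ m = 0 := by
      rw [sub_mul, h]; ring
    exact (mul_eq_zero.1 h2).resolve_left (sub_ne_zero.2 h1)
  rw [← add_sum_erase _ _ ((Polynomial.mem_nthRootsFinset hn _).2 ha)] at hsum
  linear_combination hsum

/-- The reflection `z ↦ a ^ 2 / z` permutes the roots other than `a` and exchanges `z / (a - z)`
with `-a / (a - z)`. These two add up to -1, so twice the sum is `-(n - 1)`. -/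
theorem sum_erase_nthRootsFinset_div_sub (hn : 0 < n) {a : ℂ} (ha : a ^ n = 1) :
    ∑ z ∈ (Polynomial.nthRootsFinset n (1 : ℂ)).erase a, z / (a - z) = (1 - n) / 2 := by
  have ha0 : a ≠ 0 := by
    rintro rfl
    simp [hn.ne'] at ha
  have hz : ∀ z ∈ (Polynomial.nthRootsFinset n (1 : ℂ)).erase a,
      z ≠ a ∧ z ≠ 0 ∧ z ^ n = 1 := by
    intro z hz
    obtain ⟨h1, h2⟩ := mem_erase.1 hz
    rw [Polynomial.mem_nthRootsFinset hn] at h2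
    refine ⟨h1, ?_, h2⟩
    rintro rfl
    simp [hn.ne'] at h2
  have hmap : ∀ z ∈ (Polynomial.nthRootsFinset n (1 : ℂ)).erase a,
      a ^ 2 / z ∈ (Polynomial.nthRootsFinset n (1 : ℂ)).erase a := by
    intro z h
    obtain ⟨h1, h2, h3⟩ := hz z h
    refine mem_erase.2 ⟨fun h => h1 ?_, ?_⟩
    · rw [div_eq_iff h2, pow_two] at h
      exact (mul_left_cancel₀ ha0 h).symm
    · rw [Polynomial.mem_nthRootsFinset hn, div_pow, h3, ← pow_mul, mul_comm, pow_mul, ha]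
      simp
  have hrefl : ∑ z ∈ (Polynomial.nthRootsFinset n (1 : ℂ)).erase a, z / (a - z) =
      ∑ z ∈ (Polynomial.nthRootsFinset n (1 : ℂ)).erase a, (-a / (a - z)) := by
    refine sum_nbij' (fun z => a ^ 2 / z) (fun z => a ^ 2 / z) hmap hmap ?_ ?_ ?_
    · intro z h
      have := (hz z h).2.1
      field_simp
    · intro z h
      have := (hz z h).2.1
      field_simp
    · intro z h
      obtain ⟨h1, h2, -⟩ := hz z h
      have h3 : a - z ≠ 0 := sub_ne_zero.2 h1.symm
      have h4 : z - a ≠ 0 := sub_ne_zero.2 h1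
      have h5 : a - a ^ 2 / z = a * (z - a) / z := by field_simp
      rw [h5]
      field_simp
      ring
  have hcard : (#((Polynomial.nthRootsFinset n (1 : ℂ)).erase a) : ℂ) = n - 1 := by
    rw [card_erase_of_mem ((Polynomial.mem_nthRootsFinset hn _).2 ha),
      (Complex.isPrimitiveRoot_exp n hn.ne').card_nthRootsFinset, Nat.cast_sub hn, Nat.cast_one]
  have hadd : ∑ z ∈ (Polynomial.nthRootsFinset n (1 : ℂ)).erase a, z / (a - z) +
      ∑ z ∈ (Polynomial.nthRootsFinset n (1 : ℂ)).erase a, z / (a - z) = -(n - 1) := by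
    conv_lhs => rw [hrefl]; arg 1; rw [← hrefl]
    rw [← sum_add_distrib, ← hcard, ← nsmul_one (#_), ← sum_const, ← sum_neg_distrib]
    refine sum_congr rfl fun z h => ?_
    have h3 : a - z ≠ 0 := sub_ne_zero.2 (hz z h).1.symm
    field_simp
    ring
  linear_combination hadd / 2

theorem sum_erase_nthRootsFinset_pow_div_sub {a : ℂ} (ha : a ^ n = 1) {m : ℕ} (hm : m < n) :
    ∑ z ∈ (Polynomial.nthRootsFinset n (1 : ℂ)).erase a, z ^ (m + 1) / (a - z) =
      (m + 1 - (n + 1) / 2) * a ^ m := by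
  induction m with
  | zero =>
    simp only [zero_add, pow_one]
    rw [sum_erase_nthRootsFinset_div_sub hm ha]
    push_cast
    ring
  | succ m ih =>
    -- Writing one factor `z` as `a - (a - z)` leaves a power sum equal to `-a ^ (m + 1)`, so the
    -- coefficient grows by 1.
    have hstep : ∀ z ∈ (Polynomial.nthRootsFinset n (1 : ℂ)).erase a,
        z ^ (m + 1 + 1) / (a - z) = a * (z ^ (m + 1) / (a - z)) - z ^ (m + 1) := by
      intro z h
      have h3 : a - z ≠ 0 := sub_ne_zero.2 (ne_of_mem_erase h).symm
      field_simp
      ring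
    rw [sum_congr rfl hstep, sum_sub_distrib, ← mul_sum, ih (Nat.lt_of_succ_lt hm),
      sum_erase_nthRootsFinset_pow m.succ_pos hm ha, Nat.succ_eq_add_one]
    push_cast
    ring

theorem prod_nthRootsFinset (hn : 0 < n) :
    ∏ z ∈ Polynomial.nthRootsFinset n (1 : ℂ), z = (-1) ^ (n + 1) := by
  have hζ := Complex.isPrimitiveRoot_exp n hn.ne'
  -- At 0 the factorization of `X ^ n - 1` reads `-1 = ∏ (-z)`.
  have h := congrArg (Polynomial.eval 0) (Polynomial.X_pow_sub_one_eq_prod hn hζ)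
  simp only [Polynomial.eval_sub, Polynomial.eval_pow, Polynomial.eval_X, Polynomial.eval_one,
    Polynomial.eval_prod, Polynomial.eval_C, zero_sub, zero_pow hn.ne'] at h
  rw [prod_neg, hζ.card_nthRootsFinset] at h
  have h1 : ((-1 : ℂ) ^ n) * (-1) ^ n = 1 := by rw [← mul_pow]; simp
  calc _ = ((-1 : ℂ) ^ n * (-1) ^ n) * ∏ z ∈ Polynomial.nthRootsFinset n (1 : ℂ), z := by
        rw [h1, one_mul]
    _ = _ := by rw [mul_assoc, ← h]; ring

/-- The diagonal entry contributes `(n + 1) / 2 * x i ^ m`, exactly cancelling the term `-(n + 1) /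
2` of the off-diagonal sum. The extra factor `x i` shifts the exponents to `1, …, n`, the range
where that sum is known. -/
theorem cauchyMoser_mul_pow (hn : 0 < n) {x : Fin n → ℂ} (hinj : Function.Injective x)
    (himg : univ.image x = Polynomial.nthRootsFinset n (1 : ℂ)) :
    cauchyMoser x (fun k => ((n : ℂ) + 1) / (2 * x k)) *
        Matrix.of (fun i j => x i * Matrix.vandermonde x i j) =
      Matrix.of fun i (j : Fin n) => (((j : ℕ) : ℂ) + 1) * Matrix.vandermonde x i j := by
  ext i m
  have ha : x i ^ n = 1 := by
    rw [← Polynomial.mem_nthRootsFinset hn, ← himg]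
    exact mem_image_of_mem _ (mem_univ i)
  have ha0 : x i ≠ 0 := by
    intro h
    simp [h, hn.ne'] at ha
  have hsum := sum_erase_nthRootsFinset_pow_div_sub ha m.2
  rw [← himg, ← image_erase hinj, sum_image hinj.injOn] at hsum
  have hoff : ∑ j ∈ univ.erase i, cauchyMoser x (fun k => ((n : ℂ) + 1) / (2 * x k)) i j *
      (x j * x j ^ (m : ℕ)) = (m + 1 - (n + 1) / 2) * x i ^ (m : ℕ) := by
    rw [← hsum]
    refine sum_congr rfl fun j hj => ?_
    rw [cauchyMoser_of_ne _ _ (ne_of_mem_erase hj).symm, pow_succ]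
    ring
  simp only [Matrix.mul_apply, Matrix.of_apply, Matrix.vandermonde_apply]
  rw [← add_sum_erase _ _ (mem_univ i), hoff, cauchyMoser_self]
  field_simp
  ring

theorem det_cauchyMoser_roots (hn : 0 < n) {x : Fin n → ℂ} (hinj : Function.Injective x)
    (himg : univ.image x = Polynomial.nthRootsFinset n (1 : ℂ)) :
    (cauchyMoser x fun k => ((n : ℂ) + 1) / (2 * x k)).det =
      (-1) ^ (n + 1) * (n.factorial : ℂ) := by
  have h := congrArg Matrix.det (cauchyMoser_mul_pow hn hinj himg)
  have hfact : ∏ j : Fin n, (((j : ℕ) : ℂ) + 1) = n.factorial := by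
    rw [Fin.prod_univ_eq_prod_range (fun j => (j : ℂ) + 1) n, ← prod_range_add_one_eq_factorial]
    push_cast
    rfl
  have hprod : ∏ i, x i = (-1) ^ (n + 1) := by
    rw [← prod_nthRootsFinset hn, ← himg, prod_image hinj.injOn]
  rw [Matrix.det_mul, Matrix.det_mul_column, Matrix.det_mul_row (fun j : Fin n => (((j : ℕ) : ℂ) + 1)), hfact, hprod, ← mul_assoc] at h
  have h' := mul_right_cancel₀ (Matrix.det_vandermonde_ne_zero_iff.2 hinj) h
  have h1 : ((-1 : ℂ) ^ (n + 1)) * (-1) ^ (n + 1) = 1 := by rw [← mul_pow]; simp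
  rw [← h', mul_left_comm, h1, mul_one]

end RootsOfUnity

theorem proposition40 (n : ℕ) (hn : 1 ≤ n) (x : Fin n → ℂ) (hinj : Function.Injective x)
    (hx : Set.range x = {z : ℂ | z ^ n - 1 = 0}) :
    ∑ σ ∈ involutions n,
        (∏ p ∈ transpositions σ, 1 / (x p.1 - x p.2) ^ 2) *
          ∏ k ∈ fixedPts σ, ((n : ℂ) + 1) / (2 * x k) =
      (-1) ^ (n + 1) * (n.factorial : ℂ) := by
  have himg : univ.image x = Polynomial.nthRootsFinset n (1 : ℂ) := by
    ext z
    have := Set.ext_iff.1 hx z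
    simpa [Polynomial.mem_nthRootsFinset hn, sub_eq_zero] using this
  rw [← det_cauchyMoser_roots hn hinj himg, det_cauchyMoser_eq_sum_involutions _ _ hinj]
  exact sum_congr rfl fun σ hσ =>
    (leibnizTerm_of_involutive x _ (mem_filter.1 hσ).2).symm
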